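/- **Theorem 3.** Intuitionistic propositional logic is incomplete over Prawitz's reducibility semantics, for every bound $n$ on the level of atomic bases: for every $n\in\mathbb N$ there are a finite set $\Gamma$ of formulas and a formula $A$ such that $\Gamma\models^{\alpha}_n A$ and $\Gamma\not\vdash_{\mathtt{IL}}A$. Here formulas are built from atoms (infinitely many propositional variables, and the atomic constant $\bot$) by $\wedge,\vee,\to$, and $\vdash_{\mathtt{IL}}$ is derivability in intuitionistic natural deduction. The relation $\models^\alpha_n$ is defined as follows. *Atomic bases.* An atomic rule of level $0$ is an atom. An atomic rule of higher level has atoms $A_1,\dots,A_k$ ($k\ge1$) as premises and an atom as conclusion, and may discharge in its $i$-th premise a finite set $\Re_i$ of atomic rules; its level is $1$ if all $\Re_i$ are empty, and $l+2$ if $l$ is the maximal level of the rules in the $\Re_i$. A base $\mathfrak B$ is a (possibly infinite) set of atomic rules that contains all rules "from $\bot$ infer $a$", $a$ an atom; $\mathbb B^n$ is the set of the bases all of whose other rules have level at most $n$; $\mathfrak C\supseteq_n\mathfrak B$ means $\mathfrak C\supseteq\mathfrak B$ and $\mathfrak C\in\mathbb B^n$. *Argument structures.* An argument structure $\mathscr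 D$ is a finite rooted tree labelled by formulas, whose top-nodes are assumptions or atoms used as axioms, with discharge functions that map some of the assumptions, some of the axioms, and some of the atomic inference steps (these two being regarded as assumed atomic rules) to nodes below them. An atomic rule may be discharged only at a node such that this node and its children are labelled by atoms, and no assumption is discharged at a node where atomic rules are discharged or whose inference step is itself discharged. $\mathscr D$ is from $\Gamma$ to $A$ if $\Gamma$ is the set of its undischarged assumptions and $A$ is the label of the root; it is closed if $\Gamma=\emptyset$ and open otherwise. If $\sigma$ assigns to the undischarged assumptions argument structures with these conclusions, then $\mathscr D^\sigma$ is the result of replacing the former by the latter; $\sigma$ is closed if all these structures are closed. A closed derivation in $\mathfrak B$ is an argument structure without assumptions, all of whose steps and axioms are applications of rules of $\mathfrak B$, or of assumed atomic rules which are discharged at a step of a rule that discharges them. $\mathscr D$ is canonical if its last step is an instance of an introduction rule ($\wedge_I$, $\vee_I$, $\to_I$) of natural deduction. *Reductions.* A rule is a set of inferences (argument structures ending with an inference step). A reduction for a rule $R$ is a partial map $\phi$ between argument structures, defined on some of the argument structures associated to instances of $R$, such that whenever $\phi(\mathscr D)$ is defined: if $\mathscr D$ is from $\Gamma$ to $A$,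 then $\phi(\mathscr D)$ is from some $\Gamma^*\subseteq\Gamma$ to $A$, and for all $\sigma$, $\phi(\mathscr D^\sigma)$ is defined and equal to $\phi(\mathscr D)^\sigma$. For a set $\mathfrak J$ of reductions, $\le_{\mathfrak J}$ is the reflexive-transitive closure of the replacement of a sub-structure $\mathscr D'$ by $\phi(\mathscr D')$, $\phi\in\mathfrak J$, where discharges from outside the sub-structure are preserved. *Validity.* $\langle\mathscr D,\mathfrak J\rangle$ is $n$-valid on $\mathfrak B$ iff $\mathfrak B\in\mathbb B^n$ and - if $\mathscr D$ is closed with atomic conclusion, $\mathscr D\le_{\mathfrak J}\mathscr D^*$ for some closed derivation $\mathscr D^*$ in $\mathfrak B$; - if $\mathscr D$ is closed with non-atomic conclusion, $\mathscr D\le_{\mathfrak J}\mathscr D^*$ for some canonical $\mathscr D^*$ whose immediate sub-structures are $n$-valid on $\mathfrak B$ when paired with $\mathfrak J$; - if $\mathscr D$ is open, then for every closed $\sigma$, every set of reductions $\mathfrak J^+\supseteq\mathfrak J$ and every $\mathfrak C\supseteq_n\mathfrak B$: if $\langle\sigma(\mu),\mathfrak J^+\rangle$ is $n$-valid on $\mathfrak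 C$ for every undischarged assumption $\mu$ of $\mathscr D$, then $\langle\mathscr D^\sigma,\mathfrak J^+\rangle$ is $n$-valid on $\mathfrak C$. Finally, $\Gamma\models^\alpha_n A$ holds iff there are an argument structure $\mathscr D$ from $\Gamma$ to $A$ and a set $\mathfrak J$ of reductions such that $\langle\mathscr D,\mathfrak J\rangle$ is $n$-valid on every $\mathfrak B\in\mathbb B^n$. -/

import Mathlib

namespace PTS

/-! ### Language -/

/-- Atomic formulas: infinitely many propositional variables, and the absurdity constant. -/
inductive Atom : Type
  | var (k : ℕ)
  | bot

/-- Propositional formulas. -/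
inductive Form : Type
  | atom (a : Atom)
  | and (A C : Form)
  | or (A C : Form)
  | imp (A C : Form)

/-- `⊥` as a formula. -/
def Form.bot : Form := .atom .bot

def Form.IsAtomic (A : Form) : Prop := ∃ a, A = .atom a

/-! ### Intuitionistic logic (natural deduction) -/

/-- `IL Γ A`: the formula `A` is derivable from `Γ` in intuitionistic propositional logic. -/
inductive IL : Set Form → Form → Prop
  | hyp {Γ A} : A ∈ Γ → IL Γ A
  | botE {Γ A} : IL Γ Form.bot → IL Γ A
  | andI {Γ A C} : IL Γ A → IL Γ C → IL Γ (.and A C)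
  | andE₁ {Γ A C} : IL Γ (.and A C) → IL Γ A
  | andE₂ {Γ A C} : IL Γ (.and A C) → IL Γ C
  | orI₁ {Γ A C} : IL Γ A → IL Γ (.or A C)
  | orI₂ {Γ A C} : IL Γ C → IL Γ (.or A C)
  | orE {Γ A C E} : IL Γ (.or A C) → IL (insert A Γ) E → IL (insert C Γ) E → IL Γ E
  | impI {Γ A C} : IL (insert A Γ) C → IL Γ (.imp A C)
  | impE {Γ A C} : IL Γ (.imp A C) → IL Γ A → IL Γ C

/-! ### Atomic rules and atomic bases -/

/-- Atomic rules of arbitrary level. `mk n m dis prem a` is the rule with conclusion `a` and with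
premises `prem 0, …, prem (n - 1)`, which discharges in its `i`-th premise the finite set
`{dis i 0, …, dis i (m i - 1)}` of atomic rules. -/
inductive AtRule : Type
  | mk (n : ℕ) (m : Fin n → ℕ) (dis : (i : Fin n) → Fin (m i) → AtRule)
      (prem : Fin n → Atom) (a : Atom)

/-- An atom, seen as an atomic rule (an axiom). -/
def AtRule.axm (a : Atom) : AtRule :=
  .mk 0 (fun i => i.elim0) (fun i => i.elim0) (fun i => i.elim0) a

/-- The instance of atomic explosion with conclusion `a`: from `⊥` infer `a`. -/
def AtRule.atExp (a : Atom) : AtRule :=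
  .mk 1 (fun _ => 0) (fun _ j => j.elim0) (fun _ => .bot) a

/-- The level of an atomic rule: `0` for atoms, `1` if there are premises and nothing is
discharged, and `l + 2` if `l` is the maximal level of the discharged rules. -/
def AtRule.level : AtRule → ℕ
  | .mk _ _ dis _ _ =>
    Finset.univ.sup fun i => max 1 (Finset.univ.sup fun j => (dis i j).level + 2)

/-- Atomic bases: (possibly infinite) sets of atomic rules that contain atomic explosion. -/
structure Base : Type where
  rules : Set AtRule
  atExp_mem : ∀ a, AtRule.atExp a ∈ rules

/-- The base has level at most `n`; atomic explosion is disregarded. -/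
def Base.LevelLE (n : ℕ) (𝔅 : Base) : Prop :=
  ∀ R ∈ 𝔅.rules, (∃ a, R = AtRule.atExp a) ∨ R.level ≤ n

/-- `𝔅.Ext n ℭ`: `ℭ` is an extension of `𝔅` of level at most `n`. -/
def Base.Ext (n : ℕ) (𝔅 ℭ : Base) : Prop :=
  𝔅.rules ⊆ ℭ.rules ∧ ℭ.LevelLE n

/-! ### Argument structures -/

/-- Finite trees labelled by formulas, with discharges.

A top-node is an assumption (`as`), or an atom used as an axiom (`ax`). The other nodes (`node`)
have `n + 1 ≥ 1` children. The discharge functions are recorded where they are applied: a number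
`i` stands for the node which is met `i + 1` steps further down (`0` is the parent).

* `as A i`: the assumption `A` is discharged at the node `i`. If the tree has no such node, then
  the assumption is undischarged, and `i` (counted from the root of the tree) is a mark that tells
  which undischarged assumptions are to be treated alike. In particular, the assumptions of a
  subtree that are discharged below that subtree are undischarged assumptions of the subtree,
  and they keep track of where they are discharged.
* `ax a none` is an axiom that is not discharged, `ax a (some i)` is an assumed atomic rule of
  level `0`, discharged at the node `i` if there is such a node.
* in `node A n D d` the inference step itself (the set of edges to the children) is not discharged
  if `d = none`; if `d = some i` it is an application of an assumed atomic rule which is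
  discharged at the node `i` if there is such a node. -/
inductive Str : Type
  | as (A : Form) (i : ℕ)
  | ax (a : Atom) (d : Option ℕ)
  | node (A : Form) (n : ℕ) (D : Fin (n + 1) → Str) (d : Option ℕ)

namespace Str

/-- The conclusion, i.e. the label of the root. -/
def concl : Str → Form
  | .as A _ => A
  | .ax a _ => .atom a
  | .node A _ _ _ => A

/-- The undischarged assumptions, with their marks. -/
def free : Str → Set (ℕ × Form)
  | .as A i => {(i, A)}
  | .ax _ _ => ∅
  | .node _ _ D _ => {p | ∃ j, (p.1 + 1, p.2) ∈ (D j).free}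

/-- The assumed atomic rules (labels of the premises, label of the conclusion) which are not
discharged within the tree, with their marks. -/
def freeRules : Str → Set (ℕ × List Form × Form)
  | .as _ _ => ∅
  | .ax a d => {p | d = some p.1 ∧ p.2 = ([], .atom a)}
  | .node A _ D d => {p | ∃ j, (p.1 + 1, p.2) ∈ (D j).freeRules} ∪
      {p | d = some p.1 ∧ p.2 = (List.ofFn fun j => (D j).concl, A)}

/-- The tree is an argument structure: at a node where assumed atomic rules are discharged, and at
a node which is itself an application of an assumed atomic rule, the node and all its children are
labelled by atoms, and no assumption is discharged there. -/
def WF : Str → Prop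
  | .as _ _ => True
  | .ax _ _ => True
  | .node A _ D d => (∀ j, (D j).WF) ∧
      ((d.isSome ∨ ∃ j, ∃ r, (0, r) ∈ (D j).freeRules) →
        A.IsAtomic ∧ ∀ j, (D j).concl.IsAtomic ∧ ∀ C, (0, C) ∉ (D j).free)

/-- An argument structure is closed iff all its assumptions are discharged. -/
def Closed (D : Str) : Prop := D.free = ∅

/-- `D` is from `Γ` to `A`: `Γ` is the set of the undischarged assumptions and `A` is the
conclusion. -/
def FromTo (D : Str) (Γ : Set Form) (A : Form) : Prop :=
  Prod.snd '' D.free = Γ ∧ D.concl = A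

/-- Makes room for one more node at depth `c`: the marks that point below it are increased. -/
def shift (c : ℕ) : Str → Str
  | .as A i => .as A (if i < c then i else i + 1)
  | .ax a d => .ax a (d.map fun i => if i < c then i else i + 1)
  | .node A n D d =>
      .node A n (fun j => (D j).shift (c + 1)) (d.map fun i => if i < c then i else i + 1)

/-- `σ`, as it acts above a further node: assumptions discharged at that node are kept. -/
def up (σ : ℕ → Form → Str) : ℕ → Form → Str
  | 0, A => .as A 0
  | i + 1, A => (σ i A).shift 0

/-- The instance `D^σ`: each undischarged assumption `A` with mark `i` is replaced by `σ i A`. -/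
def subst : Str → (ℕ → Form → Str) → Str
  | .as A i, σ => σ i A
  | .ax a d, _ => .ax a d
  | .node A n D d, σ => .node A n (fun j => (D j).subst (up σ)) d

/-- `σ` assigns to the undischarged assumptions of `D` argument structures for them. -/
def Inst (D : Str) (σ : ℕ → Form → Str) : Prop :=
  ∀ i A, (i, A) ∈ D.free → (σ i A).WF ∧ (σ i A).concl = A

/-- `σ` assigns to the undischarged assumptions of `D` closed argument structures for them. -/
def ClosedInst (D : Str) (σ : ℕ → Form → Str) : Prop :=
  ∀ i A, (i, A) ∈ D.free → (σ i A).WF ∧ (σ i A).concl = A ∧ (σ i A).Closed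

/-- `E` is an immediate sub-structure of `D`. -/
def ImmSub (E : Str) : Str → Prop
  | .as _ _ => False
  | .ax _ _ => False
  | .node _ _ D _ => ∃ j, E = D j

/-! ### Atomic derivations, as argument structures -/

/-- `ρ`, below a further node at which the rules in `S` are discharged. -/
def extend (S : Set AtRule) (ρ : ℕ → Set AtRule) : ℕ → Set AtRule
  | 0 => S
  | i + 1 => ρ i

/-- The rule `R` may be used with the discharge `d`: either `R` belongs to the base and is not
discharged, or `R` is an assumed rule which is discharged at a node that discharges `R`. Here `ρ i`
is the set of the rules that the node `i` discharges at this place. -/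
def Usable (𝔅 : Base) (ρ : ℕ → Set AtRule) (R : AtRule) : Option ℕ → Prop
  | none => R ∈ 𝔅.rules
  | some i => R ∈ ρ i

/-- `Der 𝔅 ρ D a`: `D` is a derivation of the atom `a` from rules of `𝔅` and from assumed rules
which are discharged within `D` or else belong to the sets `ρ i`. -/
inductive Der (𝔅 : Base) : (ℕ → Set AtRule) → Str → Atom → Prop
  | ax {ρ : ℕ → Set AtRule} {a : Atom} {d : Option ℕ} :
      Usable 𝔅 ρ (.axm a) d → Der 𝔅 ρ (.ax a d) a
  | node {ρ : ℕ → Set AtRule} {n : ℕ} {m : Fin (n + 1) → ℕ}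
      {dis : (i : Fin (n + 1)) → Fin (m i) → AtRule} {prem : Fin (n + 1) → Atom} {a : Atom}
      {D : Fin (n + 1) → Str} {d : Option ℕ} :
      Usable 𝔅 ρ (.mk (n + 1) m dis prem a) d →
      (∀ i, Der 𝔅 (extend (Set.range (dis i)) ρ) (D i) (prem i)) →
      Der 𝔅 ρ (.node (.atom a) n D d) a

/-- `D` is a derivation of `a` in `𝔅` from no assumed rules. -/
def ClosedDer (𝔅 : Base) (D : Str) (a : Atom) : Prop := Der 𝔅 (fun _ => ∅) D a

/-! ### Rules, introductions, reductions -/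

/-- A rule is a set of inferences. An inference is given by the argument structure associated to
it: premises with their structures, conclusion, and the discharges at the root. -/
abbrev Rule : Type := {R : Set Str // ∀ D ∈ R, ∃ A n E d, D = .node A n E d}

/-- Inference with one premise. -/
def inf₁ (A : Form) (D : Str) : Str := .node A 0 (fun _ => D) none

/-- Inference with two premises. -/
def inf₂ (A : Form) (D E : Str) : Str := .node A 1 ![D, E] none

/-- Introduction of conjunction: from `A` and `C` infer `A ∧ C`, nothing is discharged. -/
def andIntro (A C : Form) : Rule :=
  ⟨{D | ∃ D₁ D₂, D = inf₂ (.and A C) D₁ D₂ ∧ D₁.concl = A ∧ D₂.concl = C ∧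
    ∀ X, (0, X) ∉ D₁.free ∧ (0, X) ∉ D₂.free}, by
    rintro _ ⟨D₁, D₂, rfl, -⟩; exact ⟨_, _, _, _, rfl⟩⟩

/-- First introduction of disjunction: from `A` infer `A ∨ C`, nothing is discharged. -/
def orIntro₁ (A C : Form) : Rule :=
  ⟨{D | ∃ E, D = inf₁ (.or A C) E ∧ E.concl = A ∧ ∀ X, (0, X) ∉ E.free}, by
    rintro _ ⟨E, rfl, -⟩; exact ⟨_, _, _, _, rfl⟩⟩

/-- Second introduction of disjunction: from `C` infer `A ∨ C`, nothing is discharged. -/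
def orIntro₂ (A C : Form) : Rule :=
  ⟨{D | ∃ E, D = inf₁ (.or A C) E ∧ E.concl = C ∧ ∀ X, (0, X) ∉ E.free}, by
    rintro _ ⟨E, rfl, -⟩; exact ⟨_, _, _, _, rfl⟩⟩

/-- Introduction of implication: from `C` infer `A → C`, only assumptions `A` are discharged. -/
def impIntro (A C : Form) : Rule :=
  ⟨{D | ∃ E, D = inf₁ (.imp A C) E ∧ E.concl = C ∧ ∀ X, (0, X) ∈ E.free → X = A}, by
    rintro _ ⟨E, rfl, -⟩; exact ⟨_, _, _, _, rfl⟩⟩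

/-- An argument structure is canonical iff it ends with an introduction. -/
def Canonical (D : Str) : Prop :=
  ∃ A C, D ∈ (andIntro A C).1 ∨ D ∈ (orIntro₁ A C).1 ∨ D ∈ (orIntro₂ A C).1 ∨
    D ∈ (impIntro A C).1

/-- `φ` is a reduction for the rule `R`: a partial map between argument structures, defined on some
of the structures associated to instances of `R`, which keeps the conclusion, adds no undischarged
assumption (nor any assumed atomic rule awaiting a discharge), and commutes with instances. -/
def IsReductionFor (R : Rule) (φ : Str → Option Str) : Prop :=
  ∀ D D', φ D = some D' →
    D ∈ R.1 ∧ D.WF ∧ D'.WF ∧ D'.concl = D.concl ∧ D'.free ⊆ D.free ∧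
      D'.freeRules ⊆ D.freeRules ∧ ∀ σ, D.Inst σ → φ (D.subst σ) = some (D'.subst σ)

end Str

/-- Reductions: those for some rule. -/
abbrev Reduction : Type := {φ : Str → Option Str // ∃ R : Str.Rule, Str.IsReductionFor R φ}

namespace Str

/-- Immediate reducibility relative to `J`: some sub-structure, possibly the whole structure, is
replaced by its image under some reduction in `J`. -/
inductive Step (J : Set Reduction) : Str → Str → Prop
  | root {D D' : Str} {φ : Reduction} : φ ∈ J → φ.1 D = some D' → Step J D D'
  | sub {A : Form} {n : ℕ} {D : Fin (n + 1) → Str} {d : Option ℕ} {j : Fin (n + 1)} {E : Str} :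
      Step J (D j) E → Step J (.node A n D d) (.node A n (Function.update D j E) d)

/-- Reducibility relative to `J`. -/
def Reduces (J : Set Reduction) : Str → Str → Prop := Relation.ReflTransGen (Step J)

end Str

/-! ### Validity -/

open Str in
/-- `CVal n A J 𝔅 D`: validity on `𝔅` of the argument `⟨D, J⟩`, for a closed structure `D` with
conclusion `A`, by recursion on `A`. See `valid_iff` for the clauses that define validity. -/
def CVal (n : ℕ) : Form → Set Reduction → Base → Str → Prop
  | .atom a, J, 𝔅, D => ∃ D', Reduces J D D' ∧ ClosedDer 𝔅 D' a
  | .and A C, J, 𝔅, D => ∃ D₁ D₂, Reduces J D (inf₂ (.and A C) D₁ D₂) ∧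
      inf₂ (.and A C) D₁ D₂ ∈ (andIntro A C).1 ∧ CVal n A J 𝔅 D₁ ∧ CVal n C J 𝔅 D₂
  | .or A C, J, 𝔅, D => ∃ E, Reduces J D (inf₁ (.or A C) E) ∧
      ((inf₁ (.or A C) E ∈ (orIntro₁ A C).1 ∧ CVal n A J 𝔅 E) ∨
        (inf₁ (.or A C) E ∈ (orIntro₂ A C).1 ∧ CVal n C J 𝔅 E))
  | .imp A C, J, 𝔅, D => ∃ E, Reduces J D (inf₁ (.imp A C) E) ∧
      inf₁ (.imp A C) E ∈ (impIntro A C).1 ∧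
      (E.Closed → CVal n C J 𝔅 E) ∧
      (¬ E.Closed → ∀ σ, E.ClosedInst σ → ∀ J', J ⊆ J' → ∀ ℭ, 𝔅.Ext n ℭ →
        (∀ i X, (i, X) ∈ E.free → CVal n A J' ℭ (σ i X)) → CVal n C J' ℭ (E.subst σ))

/-- The argument `⟨D, J⟩` is `n`-valid on `𝔅`. -/
def ValidOn (n : ℕ) (𝔅 : Base) (D : Str) (J : Set Reduction) : Prop :=
  𝔅.LevelLE n ∧
  (D.Closed → CVal n D.concl J 𝔅 D) ∧
  (¬ D.Closed → ∀ σ, D.ClosedInst σ → ∀ J', J ⊆ J' → ∀ ℭ, 𝔅.Ext n ℭ →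
    (∀ i X, (i, X) ∈ D.free → CVal n X J' ℭ (σ i X)) → CVal n D.concl J' ℭ (D.subst σ))

/-! ### The defining clauses of validity -/

namespace Str

theorem Step.concl_free {J : Set Reduction} {D D' : Str} (h : Step J D D') :
    D'.concl = D.concl ∧ D'.free ⊆ D.free := by
  induction h with
  | @root D D' φ _ h =>
    obtain ⟨R, hR⟩ := φ.2
    obtain ⟨-, -, -, h₁, h₂, -⟩ := hR _ _ h
    exact ⟨h₁, h₂⟩
  | @sub A n D d j E _ ih =>
    refine ⟨rfl, ?_⟩
    rintro p ⟨k, hk⟩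
    by_cases hkj : k = j
    · subst hkj
      rw [Function.update_self] at hk
      exact ⟨k, ih.2 hk⟩
    · rw [Function.update_of_ne hkj] at hk
      exact ⟨k, hk⟩

theorem Reduces.concl_free {J : Set Reduction} {D D' : Str} (h : Reduces J D D') :
    D'.concl = D.concl ∧ D'.free ⊆ D.free := by
  induction h with
  | refl => exact ⟨rfl, subset_rfl⟩
  | tail _ h ih => exact ⟨h.concl_free.1.trans ih.1, h.concl_free.2.trans ih.2⟩

theorem Reduces.closed {J : Set Reduction} {D D' : Str} (h : Reduces J D D') (hD : D.Closed) :
    D'.Closed :=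
  Set.subset_empty_iff.1 (h.concl_free.2.trans hD.subset)

theorem free_shift (D : Str) : ∀ (c k : ℕ) (X : Form), (k, X) ∈ (D.shift c).free →
    ∃ i, (i, X) ∈ D.free ∧ k = if i < c then i else i + 1 := by
  induction D with
  | as A i =>
    intro c k X h
    simp only [shift, free, Set.mem_singleton_iff, Prod.mk.injEq] at h
    obtain ⟨h₁, rfl⟩ := h
    exact ⟨i, rfl, h₁⟩
  | ax a d => intro c k X h; exact h.elim
  | node A n D d ih =>
    rintro c k X ⟨j, hj⟩
    obtain ⟨i, hi, hk⟩ := ih j (c + 1) (k + 1) X hj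
    rcases i with _ | i
    · simp at hk
    · refine ⟨i, ⟨j, hi⟩, ?_⟩
      simp only [Nat.add_lt_add_iff_right] at hk
      split_ifs at hk ⊢ <;> omega

theorem free_subst (D : Str) : ∀ (σ : ℕ → Form → Str) (k : ℕ) (X : Form),
    (k, X) ∈ (D.subst σ).free → ∃ i A, (i, A) ∈ D.free ∧ (k, X) ∈ (σ i A).free := by
  induction D with
  | as A i => intro σ k X h; exact ⟨i, A, rfl, h⟩
  | ax a d => intro σ k X h; exact h.elim
  | node A n D d ih =>
    rintro σ k X ⟨j, hj⟩
    obtain ⟨i, B, hi, hk⟩ := ih j (up σ) (k + 1) X hj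
    rcases i with _ | i
    · simp [up, free] at hk
    · obtain ⟨k', hk', he⟩ := free_shift _ _ _ _ hk
      simp only [Nat.not_lt_zero, if_false, Nat.add_right_cancel_iff] at he
      exact ⟨i, B, ⟨j, hi⟩, he ▸ hk'⟩

theorem ClosedInst.closed_subst {D : Str} {σ : ℕ → Form → Str} (h : D.ClosedInst σ) :
    (D.subst σ).Closed := by
  refine Set.eq_empty_iff_forall_notMem.2 ?_
  rintro ⟨k, X⟩ hk
  obtain ⟨i, A, hi, hk⟩ := free_subst D σ k X hk
  rw [(h i A hi).2.2] at hk
  exact hk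

theorem ClosedInst.concl_subst {D : Str} {σ : ℕ → Form → Str} (h : D.ClosedInst σ) :
    (D.subst σ).concl = D.concl := by
  cases D with
  | as A i => exact (h i A rfl).2.1
  | ax a d => rfl
  | node A n D d => rfl

theorem inf₁_inj {A : Form} {D E : Str} (h : inf₁ A D = inf₁ A E) : D = E := by
  injection h with _ _ h
  exact congrFun h 0

theorem inf₂_inj {A : Form} {D₁ D₂ E₁ E₂ : Str} (h : inf₂ A D₁ D₂ = inf₂ A E₁ E₂) :
    D₁ = E₁ ∧ D₂ = E₂ := by
  injection h with _ _ h
  exact ⟨congrFun h 0, congrFun h 1⟩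

theorem closed_of_node {A : Form} {n : ℕ} {D : Fin (n + 1) → Str} {d : Option ℕ}
    (h : (node A n D d).Closed) (j : Fin (n + 1)) (h₀ : ∀ X, (0, X) ∉ (D j).free) :
    (D j).Closed := by
  refine Set.eq_empty_iff_forall_notMem.2 ?_
  rintro ⟨_ | k, X⟩ hk
  · exact h₀ X hk
  · exact Set.eq_empty_iff_forall_notMem.1 h (k, X) ⟨j, hk⟩

end Str

theorem validOn_of_closed {n : ℕ} {𝔅 : Base} {D : Str} {J : Set Reduction} (hD : D.Closed) :
    ValidOn n 𝔅 D J ↔ 𝔅.LevelLE n ∧ CVal n D.concl J 𝔅 D :=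
  ⟨fun h => ⟨h.1, h.2.1 hD⟩, fun h => ⟨h.1, fun _ => h.2, fun h' => (h' hD).elim⟩⟩

open Str in
/-- Validity satisfies, and is determined by, the expected clauses. -/
theorem valid_iff (n : ℕ) (𝔅 : Base) (D : Str) (J : Set Reduction) :
    ValidOn n 𝔅 D J ↔ 𝔅.LevelLE n ∧
      (D.Closed →
        (∀ a, D.concl = .atom a → ∃ D', Reduces J D D' ∧ ClosedDer 𝔅 D' a) ∧
        (¬ D.concl.IsAtomic → ∃ D', Reduces J D D' ∧ D'.Canonical ∧
          ∀ E, E.ImmSub D' → ValidOn n 𝔅 E J)) ∧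
      (¬ D.Closed → ∀ σ, D.ClosedInst σ → ∀ J', J ⊆ J' → ∀ ℭ, 𝔅.Ext n ℭ →
        (∀ i X, (i, X) ∈ D.free → ValidOn n ℭ (σ i X) J') →
          ValidOn n ℭ (D.subst σ) J') := by
  refine and_congr_right fun h𝔅 => and_congr (imp_congr_right fun hD => ?_)
    (imp_congr_right fun _ => forall_congr' fun σ => imp_congr_right fun hσ =>
      forall_congr' fun J' => imp_congr_right fun _ => forall_congr' fun ℭ =>
      imp_congr_right fun hℭ => imp_congr ?_ ?_)
  · have key : ∀ {F : Form} {D' : Str}, D.concl = F → Reduces J D D' → D'.concl = F :=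
      fun h hr => hr.concl_free.1.trans h
    rcases hF : D.concl with a | ⟨A, C⟩ | ⟨A, C⟩ | ⟨A, C⟩
    · simp [CVal, Form.IsAtomic]
    · simp only [CVal, Form.IsAtomic, reduceCtorEq, false_imp_iff, implies_true, exists_false,
        not_false_eq_true, true_imp_iff, true_and]
      constructor
      · rintro ⟨D₁, D₂, hr, hm, h₁, h₂⟩
        refine ⟨_, hr, ⟨A, C, Or.inl hm⟩, ?_⟩
        obtain ⟨E₁, E₂, he, hc₁, hc₂, hX⟩ := hm
        obtain ⟨rfl, rfl⟩ := inf₂_inj he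
        have hcl := hr.closed hD
        rintro E ⟨j, rfl⟩
        fin_cases j
        · exact (validOn_of_closed (closed_of_node hcl 0 fun X => (hX X).1)).2
            ⟨h𝔅, by simpa [hc₁] using h₁⟩
        · exact (validOn_of_closed (closed_of_node hcl 1 fun X => (hX X).2)).2
            ⟨h𝔅, by simpa [hc₂] using h₂⟩
      · rintro ⟨D', hr, ⟨A', C', hcan⟩, hsub⟩
        have hcl := hr.closed hD
        have hk := key hF hr
        rcases hcan with hm | hm | hm | hm
        · obtain ⟨D₁, D₂, rfl, hc₁, hc₂, hX⟩ := id hm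
          simp only [inf₂, concl, Form.and.injEq] at hk
          obtain ⟨rfl, rfl⟩ := hk
          refine ⟨D₁, D₂, hr, hm, ?_, ?_⟩
          · have := (hsub D₁ ⟨0, rfl⟩).2.1 (closed_of_node hcl 0 fun X => (hX X).1)
            rwa [hc₁] at this
          · have := (hsub D₂ ⟨1, rfl⟩).2.1 (closed_of_node hcl 1 fun X => (hX X).2)
            rwa [hc₂] at this
        all_goals
          obtain ⟨E, rfl, -⟩ := hm
          simp [inf₁, concl] at hk
    · simp only [CVal, Form.IsAtomic, reduceCtorEq, false_imp_iff, implies_true, exists_false,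
        not_false_eq_true, true_imp_iff, true_and]
      constructor
      · rintro ⟨E, hr, h⟩
        have hcl := hr.closed hD
        rcases h with ⟨hm, h⟩ | ⟨hm, h⟩
        · refine ⟨_, hr, ⟨A, C, Or.inr (Or.inl hm)⟩, ?_⟩
          obtain ⟨E₁, he, hc, hX⟩ := hm
          obtain rfl := inf₁_inj he
          rintro _ ⟨j, rfl⟩
          exact (validOn_of_closed (closed_of_node hcl 0 hX)).2 ⟨h𝔅, by rwa [hc]⟩
        · refine ⟨_, hr, ⟨A, C, Or.inr (Or.inr (Or.inl hm))⟩, ?_⟩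
          obtain ⟨E₁, he, hc, hX⟩ := hm
          obtain rfl := inf₁_inj he
          rintro _ ⟨j, rfl⟩
          exact (validOn_of_closed (closed_of_node hcl 0 hX)).2 ⟨h𝔅, by rwa [hc]⟩
      · rintro ⟨D', hr, ⟨A', C', hcan⟩, hsub⟩
        have hcl := hr.closed hD
        have hk := key hF hr
        rcases hcan with hm | hm | hm | hm
        · obtain ⟨D₁, D₂, rfl, -⟩ := hm
          simp [inf₂, concl] at hk
        · obtain ⟨E, rfl, hc, hX⟩ := id hm
          simp only [inf₁, concl, Form.or.injEq] at hk
          obtain ⟨rfl, rfl⟩ := hk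
          have := (hsub E ⟨0, rfl⟩).2.1 (closed_of_node hcl 0 hX)
          exact ⟨E, hr, Or.inl ⟨hm, by rwa [hc] at this⟩⟩
        · obtain ⟨E, rfl, hc, hX⟩ := id hm
          simp only [inf₁, concl, Form.or.injEq] at hk
          obtain ⟨rfl, rfl⟩ := hk
          have := (hsub E ⟨0, rfl⟩).2.1 (closed_of_node hcl 0 hX)
          exact ⟨E, hr, Or.inr ⟨hm, by rwa [hc] at this⟩⟩
        · obtain ⟨E, rfl, -⟩ := hm
          simp [inf₁, concl] at hk
    · simp only [CVal, Form.IsAtomic, reduceCtorEq, false_imp_iff, implies_true, exists_false,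
        not_false_eq_true, true_imp_iff, true_and]
      have aux : ∀ {E : Str}, (inf₁ (.imp A C) E).Closed → (∀ X, (0, X) ∈ E.free → X = A) →
          ∀ i X, (i, X) ∈ E.free → X = A := by
        rintro E hcl hX (_ | i) X hi
        · exact hX X hi
        · exact (Set.eq_empty_iff_forall_notMem.1 hcl (i, X) ⟨0, hi⟩).elim
      constructor
      · rintro ⟨E, hr, hm, h₁, h₂⟩
        have hcl := hr.closed hD
        refine ⟨_, hr, ⟨A, C, Or.inr (Or.inr (Or.inr hm))⟩, ?_⟩
        obtain ⟨E₁, he, hc, hX⟩ := hm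
        obtain rfl := inf₁_inj he
        rintro _ ⟨j, rfl⟩
        refine ⟨h𝔅, fun h => by rw [hc]; exact h₁ h, fun h σ hσ J' hJ ℭ hℭ hv => ?_⟩
        rw [hc]
        refine h₂ h σ hσ J' hJ ℭ hℭ fun i X hi => ?_
        have := hv i X hi
        rwa [aux hcl hX i X hi] at this ⊢
      · rintro ⟨D', hr, ⟨A', C', hcan⟩, hsub⟩
        have hcl := hr.closed hD
        have hk := key hF hr
        rcases hcan with hm | hm | hm | hm
        · obtain ⟨D₁, D₂, rfl, -⟩ := hm
          simp [inf₂, concl] at hk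
        · obtain ⟨E, rfl, -⟩ := hm
          simp [inf₁, concl] at hk
        · obtain ⟨E, rfl, -⟩ := hm
          simp [inf₁, concl] at hk
        · obtain ⟨E, rfl, hc, hX⟩ := id hm
          simp only [inf₁, concl, Form.imp.injEq] at hk
          obtain ⟨rfl, rfl⟩ := hk
          obtain ⟨-, h₁, h₂⟩ := hsub E ⟨0, rfl⟩
          rw [hc] at h₁ h₂
          refine ⟨E, hr, hm, h₁, fun h σ hσ J' hJ ℭ hℭ hv => h₂ h σ hσ J' hJ ℭ hℭ ?_⟩
          intro i X hi
          have := hv i X hi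
          rwa [aux hcl hX i X hi] at this ⊢
  · refine forall_congr' fun i => forall_congr' fun X => imp_congr_right fun hi => ?_
    rw [validOn_of_closed (hσ i X hi).2.2, (hσ i X hi).2.1]
    simp [hℭ.2]
  · rw [validOn_of_closed hσ.closed_subst, hσ.concl_subst]
    simp [hℭ.2]

/-- The argument `⟨D, J⟩` is `n`-valid, i.e. `n`-valid on every base of level at most `n`. -/
def Valid (n : ℕ) (D : Str) (J : Set Reduction) : Prop :=
  ∀ 𝔅 : Base, 𝔅.LevelLE n → ValidOn n 𝔅 D J

/-- `Γ ⊨ A` in reducibility semantics, for bases of level at most `n`: there is an `n`-valid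
argument from `Γ` to `A`. -/
def Conseq (n : ℕ) (Γ : Finset Form) (A : Form) : Prop :=
  ∃ (D : Str) (J : Set Reduction), D.WF ∧ D.FromTo (Γ : Set Form) A ∧ Valid n D J

end PTS

namespace PTS

namespace Str

/-! ### Substitution and renumbering -/

/-! The witness is the split rule: from `p → q ∨ r` infer `(p → q) ∨ (p → r)`, for distinct
variables. A Kripke model that branches above its root refutes it intuitionistically
(`not_il_split`).

It is valid because reductions need not be uniform. A closed structure is unchanged by
instantiation, so the map that sends one closed inference to any closed structure with the same
conclusion and no assumed rules, and is undefined elsewhere, is a reduction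
(`isReductionFor_closed`). Let the set of reductions be the set of all of them. It has no proper
extension, and a closed inference is valid as soon as some suitable structure for its conclusion
exists.

Suppose an argument for `p → q ∨ r` is valid on a base. Adding the axiom `p`, of level 0 and so
allowed for every `n`, makes `q` or `r` derivable (`CVal.exists_closedDer_addAxiom`). Say it is `q`.
In any extension where `p` has a valid argument, `p` is derivable, so the axiom can be cut
(`Der.cut`) and `q` is derivable too; the bare inference of `q` from `p` then reduces to that
derivation (`CVal.imp_of_closedDer_addAxiom`). The disjunct may vary with the base and with the
given argument: no uniform choice is required. -/

theorem subst_eq_self (D : Str) : ∀ σ : ℕ → Form → Str,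
    (∀ i A, (i, A) ∈ D.free → σ i A = .as A i) → D.subst σ = D := by
  induction D with
  | as A i => intro σ h; exact h i A rfl
  | ax a d => intro σ _; rfl
  | node A n D d ih =>
    intro σ h
    simp only [subst, node.injEq, heq_eq_eq, true_and, and_true]
    funext j
    refine ih j _ ?_
    rintro (_ | i) B hB
    · rfl
    · simp [up, h i B ⟨j, hB⟩, shift]

theorem Closed.subst_eq {D : Str} (h : D.Closed) (σ : ℕ → Form → Str) : D.subst σ = D :=
  subst_eq_self D σ fun i A hi => (Set.eq_empty_iff_forall_notMem.1 h (i, A) hi).elim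

theorem concl_shift (D : Str) (c : ℕ) : (D.shift c).concl = D.concl := by
  cases D <;> rfl

theorem freeRules_shift (D : Str) : ∀ (c k : ℕ) (r : List Form × Form),
    (k, r) ∈ (D.shift c).freeRules →
      ∃ i, (i, r) ∈ D.freeRules ∧ k = if i < c then i else i + 1 := by
  induction D with
  | as A i => intro c k r h; exact h.elim
  | ax a d =>
    rintro c k r ⟨h₁, h₂⟩
    obtain ⟨i, rfl, hi⟩ := Option.map_eq_some_iff.1 h₁
    exact ⟨i, ⟨rfl, h₂⟩, hi.symm⟩
  | node A n D d ih =>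
    rintro c k r (⟨j, hj⟩ | ⟨h₁, h₂⟩)
    · obtain ⟨i, hi, hk⟩ := ih j (c + 1) (k + 1) r hj
      rcases i with _ | i
      · simp at hk
      · refine ⟨i, Or.inl ⟨j, hi⟩, ?_⟩
        simp only [Nat.add_lt_add_iff_right] at hk
        split_ifs at hk ⊢ <;> omega
    · obtain ⟨i, rfl, hi⟩ := Option.map_eq_some_iff.1 h₁
      refine ⟨i, Or.inr ⟨rfl, ?_⟩, hi.symm⟩
      simpa only [concl_shift] using h₂

/-- The condition at a node only concerns the marks 0 in its children. These are shifted with cutoff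
at least 1, so the mark 0 is kept and no other mark becomes 0. -/
theorem WF.shift {D : Str} (h : D.WF) (c : ℕ) : (D.shift c).WF := by
  induction D generalizing c with
  | as A i => trivial
  | ax a d => trivial
  | node A n D d ih =>
    refine ⟨fun j => ih j (h.1 j) (c + 1), fun hd => ?_⟩
    have hd' : d.isSome ∨ ∃ j, ∃ r, (0, r) ∈ (D j).freeRules := by
      rcases hd with hd | ⟨j, r, hr⟩
      · exact Or.inl (by simpa using hd)
      · obtain ⟨i, hi, hk⟩ := freeRules_shift _ _ _ _ hr
        rcases i with _ | i
        · exact Or.inr ⟨j, r, hi⟩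
        · split_ifs at hk
    refine ⟨(h.2 hd').1, fun j => ⟨by rw [concl_shift]; exact ((h.2 hd').2 j).1, fun C hC => ?_⟩⟩
    obtain ⟨i, hi, hk⟩ := free_shift _ _ _ _ hC
    rcases i with _ | i
    · exact ((h.2 hd').2 j).2 C hi
    · split_ifs at hk

theorem Closed.shift {D : Str} (h : D.Closed) (c : ℕ) : (D.shift c).Closed := by
  refine Set.eq_empty_iff_forall_notMem.2 ?_
  rintro ⟨k, X⟩ hk
  obtain ⟨i, hi, -⟩ := free_shift _ _ _ _ hk
  exact Set.eq_empty_iff_forall_notMem.1 h _ hi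

/-! ### Inferences with one premise -/

theorem Closed.inf₁ {D : Str} (h : D.Closed) (A : Form) : (inf₁ A D).Closed := by
  refine Set.eq_empty_iff_forall_notMem.2 ?_
  rintro p ⟨_, hp⟩
  exact Set.eq_empty_iff_forall_notMem.1 h _ hp

theorem WF.inf₁ {D : Str} (h : D.WF) (hr : ∀ r, (0, r) ∉ D.freeRules) (A : Form) :
    (inf₁ A D).WF := by
  refine ⟨fun _ => h, ?_⟩
  rintro (h' | ⟨_, r, h'⟩)
  · exact absurd h' (by simp)
  · exact (hr r h').elim

/-- Shifting with cutoff 0 leaves no mark 0, so the new node discharges nothing. -/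
theorem WF.inf₁_shift {D : Str} (h : D.WF) (A : Form) : (Str.inf₁ A (D.shift 0)).WF := by
  refine (h.shift 0).inf₁ (fun r hr => ?_) A
  obtain ⟨i, -, hi⟩ := freeRules_shift _ _ _ _ hr
  simp at hi

/-- The inference of `C` from the assumption `A`, which is left undischarged with mark `0`. -/
def infer (A C : Form) : Str := inf₁ C (.as A 1)

theorem free_infer (A C : Form) : (infer A C).free = {(0, A)} := by
  ext ⟨i, X⟩
  simp [infer, inf₁, free]

theorem freeRules_infer (A C : Form) : (infer A C).freeRules = ∅ := by
  ext ⟨i, X⟩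
  simp [infer, inf₁, freeRules]

theorem wf_infer (A C : Form) : (infer A C).WF :=
  WF.inf₁ (D := .as A 1) trivial (fun _ h => h) C

theorem not_closed_infer (A C : Form) : ¬ (infer A C).Closed := by
  rw [Closed, free_infer]
  exact Set.singleton_ne_empty _

theorem subst_infer (A C : Form) (σ : ℕ → Form → Str) :
    (infer A C).subst σ = inf₁ C ((σ 0 A).shift 0) := rfl

theorem closed_imp_infer (A C : Form) : (inf₁ (.imp A C) (infer A C)).Closed := by
  refine Set.eq_empty_iff_forall_notMem.2 ?_
  rintro ⟨i, X⟩ ⟨_, h⟩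
  rw [free_infer] at h
  simp at h

theorem freeRules_imp_infer (A C : Form) : (inf₁ (.imp A C) (infer A C)).freeRules = ∅ := by
  ext ⟨i, X⟩
  simp [inf₁, freeRules, freeRules_infer]

theorem wf_imp_infer (A C : Form) : (inf₁ (.imp A C) (infer A C)).WF :=
  (wf_infer A C).inf₁ (by simp [freeRules_infer]) _

/-! ### Reductions of closed structures -/

open Classical in
/-- A single closed inference may be reduced to any closed structure for the same conclusion
without assumed atomic rules. -/
theorem isReductionFor_closed {A : Form} {n : ℕ} {E : Fin (n + 1) → Str} {d : Option ℕ} {D' : Str}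
    (hw : (node A n E d).WF) (hc : (node A n E d).Closed) (hw' : D'.WF) (hc' : D'.Closed)
    (hA : D'.concl = A) (hr : D'.freeRules = ∅) :
    IsReductionFor ⟨{node A n E d}, fun _ h => ⟨A, n, E, d, h⟩⟩
      (fun D => if D = node A n E d then some D' else none) := by
  intro D F hF
  change (if D = node A n E d then some D' else none) = some F at hF
  split_ifs at hF with h
  obtain rfl := Option.some.inj hF
  subst h
  refine ⟨rfl, hw, hw', hA, hc'.subset.trans (Set.empty_subset _),
    by rw [hr]; exact Set.empty_subset _, fun σ _ => ?_⟩
  -- Both sides are closed, so commutation with instances is trivial.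
  rw [hc.subst_eq, hc'.subst_eq]
  exact if_pos rfl

/-- The source of all reduction steps in the proof: the target need not be related to the premises
of the inference that it replaces. -/
theorem reduces_univ_of_closed {A : Form} {n : ℕ} {E : Fin (n + 1) → Str} {d : Option ℕ} {D' : Str}
    (hw : (node A n E d).WF) (hc : (node A n E d).Closed) (hw' : D'.WF) (hc' : D'.Closed)
    (hA : D'.concl = A) (hr : D'.freeRules = ∅) :
    Reduces Set.univ (node A n E d) D' := by
  classical
  exact .single <| .root (φ := ⟨_, _, isReductionFor_closed hw hc hw' hc' hA hr⟩)
    (Set.mem_univ _) (if_pos rfl)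

/-! ### Atomic derivations -/

theorem Der.concl_eq {𝔅 : Base} {ρ : ℕ → Set AtRule} {D : Str} {a : Atom} (h : Der 𝔅 ρ D a) :
    D.concl = .atom a := by
  cases h <;> rfl

theorem Der.free_eq {𝔅 : Base} {ρ : ℕ → Set AtRule} {D : Str} {a : Atom} (h : Der 𝔅 ρ D a) :
    D.free = ∅ := by
  induction h with
  | ax _ => rfl
  | node _ _ ih =>
    refine Set.eq_empty_iff_forall_notMem.2 ?_
    rintro p ⟨j, hp⟩
    exact Set.eq_empty_iff_forall_notMem.1 (ih j) _ hp

theorem Der.wf {𝔅 : Base} {ρ : ℕ → Set AtRule} {D : Str} {a : Atom} (h : Der 𝔅 ρ D a) :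
    D.WF := by
  induction h with
  | ax _ => trivial
  | node _ hD ih =>
    exact ⟨ih, fun _ => ⟨⟨_, rfl⟩, fun j => ⟨⟨_, (hD j).concl_eq⟩, fun C hC =>
      Set.eq_empty_iff_forall_notMem.1 (hD j).free_eq _ hC⟩⟩⟩

/-- A pending discharge at `i` comes from a rule taken from `ρ i`. With every `ρ i` empty, closed
derivations have no pending rules and may serve as values of reductions. -/
theorem Der.nonempty_of_mem_freeRules {𝔅 : Base} {ρ : ℕ → Set AtRule} {D : Str} {a : Atom}
    (h : Der 𝔅 ρ D a) : ∀ {i r}, (i, r) ∈ D.freeRules → (ρ i).Nonempty := by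
  induction h with
  | ax hu =>
    rintro i r ⟨rfl, -⟩
    exact ⟨_, hu⟩
  | node hu _ ih =>
    rintro i r (⟨j, hj⟩ | ⟨rfl, -⟩)
    · exact ih j hj
    · exact ⟨_, hu⟩

theorem ClosedDer.freeRules_eq {𝔅 : Base} {D : Str} {a : Atom} (h : ClosedDer 𝔅 D a) :
    D.freeRules = ∅ := by
  refine Set.eq_empty_iff_forall_notMem.2 ?_
  rintro ⟨i, r⟩ hr
  exact Set.not_nonempty_empty (h.nonempty_of_mem_freeRules hr)

theorem extend_mono {ρ ρ' : ℕ → Set AtRule} (h : ∀ i, ρ i ⊆ ρ' i) (S : Set AtRule) :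
    ∀ i, extend S ρ i ⊆ extend S ρ' i
  | 0 => subset_rfl
  | i + 1 => h i

theorem Usable.mono {𝔅 ℭ : Base} {ρ ρ' : ℕ → Set AtRule} {R : AtRule} {d : Option ℕ}
    (hB : 𝔅.rules ⊆ ℭ.rules) (hρ : ∀ i, ρ i ⊆ ρ' i) (h : Usable 𝔅 ρ R d) : Usable ℭ ρ' R d := by
  cases d with
  | none => exact hB h
  | some i => exact hρ i h

/-- Enlarging `ρ` allows a closed derivation to be placed, unchanged, above nodes that discharge
rules. -/
theorem Der.mono {𝔅 ℭ : Base} {ρ ρ' : ℕ → Set AtRule} {D : Str} {a : Atom}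
    (hB : 𝔅.rules ⊆ ℭ.rules) (hρ : ∀ i, ρ i ⊆ ρ' i) (h : Der 𝔅 ρ D a) : Der ℭ ρ' D a := by
  induction h generalizing ρ' with
  | ax hu => exact .ax (hu.mono hB hρ)
  | node hu _ ih => exact .node (hu.mono hB hρ) fun i => ih i (extend_mono hρ _)

end Str

open Str

/-- The extension of a base by the axiom `p`. -/
def Base.addAxiom (𝔅 : Base) (p : Atom) : Base where
  rules := insert (.axm p) 𝔅.rules
  atExp_mem a := Set.mem_insert_of_mem _ (𝔅.atExp_mem a)

theorem AtRule.level_axm (a : Atom) : (AtRule.axm a).level = 0 := by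
  simp [AtRule.axm, AtRule.level]

/-- An axiom has the least level, which is why the bound on levels plays no role, not even for `n =
0`. -/
theorem Base.ext_addAxiom {n : ℕ} {𝔅 : Base} (h : 𝔅.LevelLE n) (p : Atom) :
    𝔅.Ext n (𝔅.addAxiom p) := by
  refine ⟨Set.subset_insert _ _, ?_⟩
  rintro R (rfl | hR)
  · exact Or.inr (by simp [AtRule.level_axm])
  · exact h R hR

/-- An axiom that is derivable may be cut. -/
theorem Str.Der.cut {𝔅 : Base} {p : Atom} {P : Str} (hP : ClosedDer 𝔅 P p) {ρ : ℕ → Set AtRule}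
    {D : Str} {a : Atom} (h : Der (𝔅.addAxiom p) ρ D a) : ∃ D', Der 𝔅 ρ D' a := by
  induction h with
  | @ax ρ a d hu =>
    cases d with
    | none =>
      rcases hu with hu | hu
      · have hap : a = p := by
          simp only [AtRule.axm, AtRule.mk.injEq] at hu
          exact hu.2.2.2.2
        -- Each undischarged use of the axiom `p` is replaced by `P`, which needs no renumbering
        -- since it assumes no rules.
        exact ⟨P, hap ▸ hP.mono subset_rfl fun _ => Set.empty_subset _⟩
      · exact ⟨_, .ax (d := none) hu⟩
    | some i => exact ⟨_, .ax (d := some i) hu⟩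
  | @node ρ n m dis prem a D d hu _ ih =>
    choose D' hD' using ih
    refine ⟨.node (.atom a) n D' d, .node (dis := dis) ?_ hD'⟩
    cases d with
    | none =>
      rcases hu with hu | hu
      -- The new axiom has no premises, so it cannot be the rule applied at an inner node.
      · simp [AtRule.axm] at hu
      · exact hu
    | some i => exact hu

/-! ### Validity relative to the set of all reductions -/

theorem CVal.exists_closedDer {n : ℕ} {a : Atom} {J : Set Reduction} {𝔅 : Base} {D : Str}
    (h : CVal n (.atom a) J 𝔅 D) : ∃ D', ClosedDer 𝔅 D' a := by
  obtain ⟨D', -, h⟩ := h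
  exact ⟨D', h⟩

theorem CVal.exists_closedDer_or {n : ℕ} {a b : Atom} {J : Set Reduction} {𝔅 : Base} {D : Str}
    (h : CVal n (.or (.atom a) (.atom b)) J 𝔅 D) :
    (∃ D', ClosedDer 𝔅 D' a) ∨ ∃ D', ClosedDer 𝔅 D' b := by
  obtain ⟨E, -, ⟨-, h⟩ | ⟨-, h⟩⟩ := h
  · exact Or.inl h.exists_closedDer
  · exact Or.inr h.exists_closedDer

/-- A valid closed argument for `p → q ∨ r` yields a derivation of `q` or of `r` in the extension
of the base by the axiom `p`. -/
theorem CVal.exists_closedDer_addAxiom {n : ℕ} {p q r : Atom} {J : Set Reduction} {𝔅 : Base}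
    {D : Str} (h𝔅 : 𝔅.LevelLE n) (hD : D.Closed)
    (h : CVal n (.imp (.atom p) (.or (.atom q) (.atom r))) J 𝔅 D) :
    (∃ D', ClosedDer (𝔅.addAxiom p) D' q) ∨ ∃ D', ClosedDer (𝔅.addAxiom p) D' r := by
  obtain ⟨E, hr, ⟨E', he, -, hX⟩, hcl, hop⟩ := h
  obtain rfl := inf₁_inj he
  have hext := Base.ext_addAxiom h𝔅 p
  by_cases hE : E.Closed
  -- The introduction discharges nothing here: one disjunct is already derivable without `p`.
  · refine (hcl hE).exists_closedDer_or.imp ?_ ?_ <;>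
    · rintro ⟨D', h⟩
      exact ⟨D', h.mono hext.1 fun _ => subset_rfl⟩
  · have hfree : ∀ i X, (i, X) ∈ E.free → X = .atom p := by
      rintro (_ | i) X hi
      · exact hX X hi
      · exact (Set.eq_empty_iff_forall_notMem.1 (hr.closed hD) (i, X) ⟨0, hi⟩).elim
    -- All open assumptions of `E` are `p`, so the axiom itself is a closed valid argument for each
    -- of them on the extended base.
    refine (hop hE (fun _ _ => .ax p none) (fun i X hi => ⟨trivial, (hfree i X hi).symm, rfl⟩)
      J subset_rfl _ hext fun i X hi => ?_).exists_closedDer_or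
    exact ⟨_, .refl, .ax (d := none) (Set.mem_insert _ _)⟩

/-- If `q` is derivable from the additional axiom `p`, then the inference of `q` from `p`, followed
by an introduction, is valid relative to the set of all reductions. -/
theorem CVal.imp_of_closedDer_addAxiom {n : ℕ} {p q : Atom} {𝔅 : Base} {Q : Str}
    (h : ClosedDer (𝔅.addAxiom p) Q q) :
    CVal n (.imp (.atom p) (.atom q)) Set.univ 𝔅
      (inf₁ (.imp (.atom p) (.atom q)) (infer (.atom p) (.atom q))) := by
  refine ⟨_, .refl, ⟨_, rfl, rfl, fun X hX => ?_⟩, fun hc => (not_closed_infer _ _ hc).elim,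
    fun _ σ hσ J' hJ ℭ hℭ hv => ?_⟩
  · rw [free_infer] at hX
    exact congrArg Prod.snd hX
  -- There is nothing to add to the set of all reductions, so the reduction needed below is
  -- available in `J'`.
  · obtain rfl := Set.univ_subset_iff.1 hJ
    have h0 : (0, Form.atom p) ∈ (infer (.atom p) (.atom q)).free := by simp [free_infer]
    obtain ⟨P, hP⟩ := (hv 0 _ h0).exists_closedDer
    have hsub : (𝔅.addAxiom p).rules ⊆ (ℭ.addAxiom p).rules := Set.insert_subset_insert hℭ.1
    -- `Q` still derives `q` over the larger base with the axiom `p`, and `P` derives `p` there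
    -- without it.
    obtain ⟨Q', hQ'⟩ := Der.cut hP (h.mono hsub fun _ => subset_rfl)
    obtain ⟨hw, -, hc⟩ := hσ 0 _ h0
    exact ⟨Q', reduces_univ_of_closed (hw.inf₁_shift _) ((hc.shift 0).inf₁ _) hQ'.wf hQ'.free_eq
      hQ'.concl_eq (ClosedDer.freeRules_eq hQ'), hQ'⟩

/-- Disjunctions of atoms split under an atomic antecedent in reducibility semantics, for every bound on the level
of the bases. -/
theorem conseq_split (n : ℕ) (p q r : Atom) :
    Conseq n {.imp (.atom p) (.or (.atom q) (.atom r))}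
      (.or (.imp (.atom p) (.atom q)) (.imp (.atom p) (.atom r))) := by
  -- A single unjustified step suffices. Its closed instances end with an inference even when the
  -- structure put for the assumption does not, so a reduction can act at the root.
  refine ⟨infer (.imp (.atom p) (.or (.atom q) (.atom r))) _, Set.univ, wf_infer _ _,
    ⟨by simp [free_infer], rfl⟩, fun 𝔅 h𝔅 => ⟨h𝔅,
    fun hc => (not_closed_infer _ _ hc).elim, fun _ σ hσ J' hJ ℭ hℭ hv => ?_⟩⟩
  obtain rfl := Set.univ_subset_iff.1 hJ
  rw [subst_infer]
  have h0 := (free_infer (.imp (.atom p) (.or (.atom q) (.atom r)))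
    (.or (.imp (.atom p) (.atom q)) (.imp (.atom p) (.atom r)))).symm.subset rfl
  obtain ⟨hw, -, hc⟩ := hσ 0 _ h0
  have hred : ∀ a b : Atom, ∀ A : Form, Reduces Set.univ (inf₁ A ((σ 0 _).shift 0))
      (inf₁ A (inf₁ (.imp (.atom a) (.atom b)) (infer (.atom a) (.atom b)))) := fun a b A =>
    reduces_univ_of_closed (hw.inf₁_shift _) ((hc.shift 0).inf₁ _)
      ((wf_imp_infer _ _).inf₁ (by simp [freeRules_imp_infer]) _) ((closed_imp_infer _ _).inf₁ _)
      rfl (by ext ⟨i, X⟩; simp [inf₁, freeRules, freeRules_infer])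
  have hclosed : ∀ (a b : Atom) (X : Form),
      (0, X) ∉ (inf₁ (.imp (.atom a) (.atom b)) (infer (.atom a) (.atom b))).free := fun a b X =>
    Set.eq_empty_iff_forall_notMem.1 (closed_imp_infer _ _) _
  -- The disjunct to introduce is chosen only now, with `ℭ` and `σ` fixed.
  rcases (hv 0 _ h0).exists_closedDer_addAxiom hℭ.2 hc with ⟨Q, hQ⟩ | ⟨Q, hQ⟩
  · exact ⟨_, hred p q _, Or.inl ⟨⟨_, rfl, rfl, hclosed p q⟩, .imp_of_closedDer_addAxiom hQ⟩⟩
  · exact ⟨_, hred p r _, Or.inr ⟨⟨_, rfl, rfl, hclosed p r⟩, .imp_of_closedDer_addAxiom hQ⟩⟩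

/-! ### Kripke models -/

/-- Kripke forcing over a preorder of worlds, for a valuation of the propositional variables. -/
def Force {W : Type*} [Preorder W] (V : ℕ → W → Prop) : Form → W → Prop
  | .atom (.var k), w => V k w
  | .atom .bot, _ => False
  | .and A C, w => Force V A w ∧ Force V C w
  | .or A C, w => Force V A w ∨ Force V C w
  | .imp A C, w => ∀ v, w ≤ v → Force V A v → Force V C v

theorem Force.mono {W : Type*} [Preorder W] {V : ℕ → W → Prop}
    (hV : ∀ k w v, w ≤ v → V k w → V k v) (A : Form) :
    ∀ {w v}, w ≤ v → Force V A w → Force V A v := by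
  induction A with
  | atom a =>
    cases a with
    | var k => exact fun h => hV k _ _ h
    | bot => exact fun _ => id
  | and A C ihA ihC => exact fun h => And.imp (ihA h) (ihC h)
  | or A C ihA ihC => exact fun h => Or.imp (ihA h) (ihC h)
  | imp A C => exact fun h hw u hu => hw u (h.trans hu)

/-- Soundness by induction on derivations; persistence carries the context to later worlds in the
case of `impI`. -/
theorem IL.force {W : Type*} [Preorder W] {V : ℕ → W → Prop}
    (hV : ∀ k w v, w ≤ v → V k w → V k v) {Γ : Set Form} {A : Form} (h : IL Γ A) :
    ∀ w, (∀ X ∈ Γ, Force V X w) → Force V A w := by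
  induction h with
  | hyp h => exact fun w hw => hw _ h
  | botE _ ih => exact fun w hw => (ih w hw).elim
  | andI _ _ ih₁ ih₂ => exact fun w hw => ⟨ih₁ w hw, ih₂ w hw⟩
  | andE₁ _ ih => exact fun w hw => (ih w hw).1
  | andE₂ _ ih => exact fun w hw => (ih w hw).2
  | orI₁ _ ih => exact fun w hw => Or.inl (ih w hw)
  | orI₂ _ ih => exact fun w hw => Or.inr (ih w hw)
  | orE _ _ _ ih ih₁ ih₂ =>
    intro w hw
    rcases ih w hw with h | h
    · exact ih₁ w (Set.forall_mem_insert.2 ⟨h, hw⟩)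
    · exact ih₂ w (Set.forall_mem_insert.2 ⟨h, hw⟩)
  | impI _ ih =>
    exact fun w hw v hv hA =>
      ih v (Set.forall_mem_insert.2 ⟨hA, fun X hX => Force.mono hV X hv (hw X hX)⟩)
  | impE _ _ ih₁ ih₂ => exact fun w hw => ih₁ w hw w le_rfl (ih₂ w hw)

/-- In the Kripke model, worlds are sets of Booleans ordered by inclusion; `0` holds in the nonempty ones,
`1` and `2` in those that contain `true` and `false`, respectively. -/
theorem not_il_split :
    ¬ IL {.imp (.atom (.var 0)) (.or (.atom (.var 1)) (.atom (.var 2)))}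
      (.or (.imp (.atom (.var 0)) (.atom (.var 1))) (.imp (.atom (.var 0)) (.atom (.var 2)))) := by
  intro h
  let V : ℕ → Set Bool → Prop
    | 0, w => w ≠ ∅
    | 1, w => true ∈ w
    | 2, w => false ∈ w
    | _, _ => False
  have hV : ∀ k w v, w ≤ v → V k w → V k v := by
    rintro (_ | _ | _ | k) w v hwv hw
    · exact fun hv => hw (Set.subset_empty_iff.1 (hv ▸ hwv))
    · exact hwv hw
    · exact hwv hw
    · exact hw
  have hroot := h.force hV ∅ (by
    rintro X rfl v - hv
    obtain ⟨b, hb⟩ := Set.nonempty_iff_ne_empty.2 hv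
    cases b
    · exact Or.inr hb
    · exact Or.inl hb)
  rcases hroot with h | h
  -- Each singleton forces the antecedent and only one of the disjuncts, so it refutes the
  -- implication to the other one at the root `∅`.
  · have : true ∈ ({false} : Set Bool) := h {false} (Set.empty_subset _) (Set.singleton_ne_empty _)
    simp at this
  · have : false ∈ ({true} : Set Bool) := h {true} (Set.empty_subset _) (Set.singleton_ne_empty _)
    simp at this

end PTS

theorem theorem3 (n : ℕ) :
    ∃ (Γ : Finset PTS.Form) (A : PTS.Form), PTS.Conseq n Γ A ∧ ¬ PTS.IL (Γ : Set PTS.Form) A := by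
  refine ⟨_, _, PTS.conseq_split n (.var 0) (.var 1) (.var 2), ?_⟩
  rw [Finset.coe_singleton]
  exact PTS.not_il_split
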